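/- **Theorem (Straubing Theorem for $\mathbf T$-algebras).** *Setting.* Let $\mathcal D$ be a variety of finitary one-sorted algebras (presented by equations) or of ordered algebras (presented by inequations), and let $\mathcal C$ be a variety of finitary one-sorted algebras. Assume that both are locally finite (finitely generated algebras are finite), that all epimorphisms of $\mathcal D$ are surjective, that the signature of $\mathcal C$ contains a constant $c$, which we fix, and that we are given a dual equivalence $E$ from the category $\mathcal D_f$ of finite $\mathcal D$-algebras to the category $\mathcal C_f$ of finite $\mathcal C$-algebras. Let $S$ be a finite set of sorts, $\mathbf T$ a monad on the product category $\mathcal D^S$ whose functor $T$ preserves epimorphisms, and $\mathcal F$ a class of finite $\mathbf T$-algebras closed under quotients (sortwise surjective homomorphic images), subalgebras (given by sortwise injective, in the ordered case order-reflecting, homomorphisms) and finite products. Let $\mathbb A$ be a class of finite $S$-sorted sets, called alphabets. For $\Sigma\in\mathbb A$ let $\mathbf T\mathbb\Sigma$ be the free $\mathbf T$-algebra on the free object $\mathbb\Sigma$ of $\mathcal D^S$ generated by $\Sigma$. Quotients in $\mathcal D^S$ are the sortwise surjective morphisms. *Unary presentations.* A unary operation on $X\in\mathcal D^S$ is a $\mathcal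 D$-morphism $u\colon X_s\to X_t$ between two sorts. For each $\Sigma\in\mathbb A$ fix a unary presentation $\mathbb U_\Sigma$ of $\mathbf T\mathbb\Sigma$, i.e. a set of unary operations on $T\mathbb\Sigma$ such that, for every quotient $e\colon T\mathbb\Sigma\twoheadrightarrow B$ in $\mathcal D^S$ that factorizes through some surjective $\mathbf T$-homomorphism $\mathbf T\mathbb\Sigma\twoheadrightarrow Q$ with $Q\in\mathcal F$: $B$ carries a $\mathbf T$-algebra structure making $e$ a $\mathbf T$-homomorphism if and only if every $u\colon (T\mathbb\Sigma)_s\to(T\mathbb\Sigma)_t$ in $\mathbb U_\Sigma$ lifts along $e$, i.e. $e_t\cdot u=v\cdot e_s$ for some $\mathcal D$-morphism $v\colon B_s\to B_t$. *Languages.* Let $O\in\mathcal D_f$ be the dual of the free $\mathcal C$-algebra $\mathbb 1_{\mathcal C}$ on one generator. For $A\in\mathcal D_f$ one has $|E A|\cong\mathcal C(\mathbb 1_{\mathcal C},EA)\cong\mathcal D(A,O)$, so $\mathcal D(A,O)$ is a $\mathcal C$-algebra, naturally in $A$. These operations extend uniquely to operations on $\mathcal D(X,O)$ natural in all $X\in\mathcal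 D$ (compose the tuple $\langle f_1,\dots,f_n\rangle\colon X\to O^n$ with the morphism $O^n\to O$ obtained by applying the operation to the $n$ projections in $\mathcal D(O^n,O)$). A language over $\Sigma$ is a morphism $L=(L_s\colon (T\mathbb\Sigma)_s\to O)_{s\in S}$ of $\mathcal D^S$; it is $\mathcal F$-recognizable if $L=p\cdot h$ for some $\mathbf T$-homomorphism $h\colon\mathbf T\mathbb\Sigma\to A$ with $A\in\mathcal F$ and some morphism $p=(p_s\colon A_s\to O)_{s\in S}$ of $\mathcal D^S$. The operations of $\mathcal C$ act sortwise on languages. The derivative $u^{-1}L$ of $L$ with respect to $u\colon(T\mathbb\Sigma)_s\to(T\mathbb\Sigma)_t$ is $L_t\cdot u$ in sort $s$ and is the value of the constant $c$ in $\mathcal D((T\mathbb\Sigma)_r,O)$ in every sort $r\ne s$. The diagonal of a family $(L^s)_{s\in S}$ of languages is the language with component $L^s_s$ in sort $s$. A local variety of languages over $\Sigma$ is a set of $\mathcal F$-recognizable languages over $\Sigma$ closed under all operations of $\mathcal C$, under derivatives with respect to all $u\in\mathbb U_\Sigma$, and under diagonals. *Local pseudovarieties.* Order the surjective $\mathbf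 T$-homomorphisms $e\colon\mathbf T\mathbb\Sigma\twoheadrightarrow A$ with $A\in\mathcal F$ by $e\le e'$ iff $e=q\cdot e'$ for some $\mathbf T$-homomorphism $q$ (identifying isomorphic ones). A local pseudovariety of $\Sigma$-generated $\mathcal F$-algebras is a nonempty, directed, downwards closed class of such quotients. *Relativization.* Let $\mathsf C$ be a family associating to each pair $\Delta,\Sigma\in\mathbb A$ an arbitrary set $\mathsf C(\Delta,\Sigma)$ of $\mathbf T$-homomorphisms $\mathbf T\mathbb\Delta\to\mathbf T\mathbb\Sigma$. - A $\mathsf C$-variety of languages is a family $(W_\Sigma)_{\Sigma\in\mathbb A}$ of local varieties of languages $W_\Sigma$ over $\Sigma$ such that $L\cdot g\in W_\Delta$ for all $\Delta,\Sigma\in\mathbb A$, $g\in\mathsf C(\Delta,\Sigma)$ and $L\in W_\Sigma$. - An $\mathcal F$-theory with respect to $\mathsf C$ is a family $(\mathcal T_\Sigma)_{\Sigma\in\mathbb A}$ of local pseudovarieties $\mathcal T_\Sigma$ of $\Sigma$-generated $\mathcal F$-algebras such that for all $\Delta,\Sigma\in\mathbb A$, $g\in\mathsf C(\Delta,\Sigma)$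 and $e\colon\mathbf T\mathbb\Sigma\twoheadrightarrow A$ in $\mathcal T_\Sigma$ there are $\overline e\colon\mathbf T\mathbb\Delta\twoheadrightarrow B$ in $\mathcal T_\Delta$ and a $\mathbf T$-homomorphism $\overline g\colon B\to A$ with $\overline g\cdot\overline e=e\cdot g$. Both are ordered by componentwise inclusion. *Claim.* The $\mathsf C$-varieties of languages and the $\mathcal F$-theories with respect to $\mathsf C$ form lattices, and these two lattices are isomorphic. -/

import Mathlib

open CategoryTheory FirstOrder

universe w u

namespace Straubing

/-! ### Varieties of algebras and of ordered algebras -/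

/-- A presentation of a one-sorted finitary variety. `lang` is the signature (function symbols only).
If `ordered` holds, this is a variety of ordered algebras, presented by the inequations `s ≤ t` for
`(s, t) ∈ rels`. Otherwise it is a variety of (unordered) algebras, presented by the equations
`s = t` for `(s, t) ∈ rels`. -/
structure Variety where
  /-- the signature -/
  lang : FirstOrder.Language.{u, 0}
  algebraic : lang.IsAlgebraic
  /-- is it a variety of ordered algebras? -/
  ordered : Prop
  /-- the defining (in)equations, between terms with variables in `ℕ` -/
  rels : Set (lang.Term ℕ × lang.Term ℕ)

/-- The algebras of a variety. In the unordered case the order is required to be the discrete one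
(it carries no information, and `≤` just means `=`), so that both cases are treated uniformly. -/
structure Variety.Alg (V : Variety.{u}) where
  /-- the underlying set -/
  carrier : Type u
  [str : V.lang.Structure carrier]
  [order : PartialOrder carrier]
  monotone_op : ∀ {n : ℕ} (f : V.lang.Functions n),
    Monotone (fun x : Fin n → carrier => Language.Structure.funMap f x)
  sat : ∀ r ∈ V.rels, ∀ v : ℕ → carrier, r.1.realize v ≤ r.2.realize v
  discrete : ¬ V.ordered → ∀ a b : carrier, a ≤ b → a = b

attribute [instance] Variety.Alg.str Variety.Alg.order

namespace Variety

variable {V : Variety.{u}}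

/-- Morphisms: (monotone) homomorphisms. Monotonicity is automatic in the unordered case. -/
@[ext]
structure Alg.Hom (A B : V.Alg) where
  /-- the underlying map -/
  toFun : A.carrier → B.carrier
  map_op : ∀ {n : ℕ} (f : V.lang.Functions n) (x : Fin n → A.carrier),
    toFun (Language.Structure.funMap f x) = Language.Structure.funMap f (toFun ∘ x)
  monotone : Monotone toFun

instance : Category V.Alg where
  Hom A B := Alg.Hom A B
  id A := ⟨id, fun _ _ => rfl, monotone_id⟩
  comp f g := ⟨g.toFun ∘ f.toFun, fun o x => by
    simp [f.map_op, g.map_op, Function.comp_assoc], g.monotone.comp f.monotone⟩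

@[ext]
theorem Alg.hom_ext {A B : V.Alg} {f g : A ⟶ B} (h : ∀ a, f.toFun a = g.toFun a) : f = g :=
  Alg.Hom.ext (funext h)

@[simp]
theorem Alg.comp_toFun {A B D : V.Alg} (f : A ⟶ B) (g : B ⟶ D) (a : A.carrier) :
    (f ≫ g).toFun a = g.toFun (f.toFun a) := rfl

@[simp]
theorem Alg.id_toFun {A : V.Alg} (a : A.carrier) : Alg.Hom.toFun (𝟙 A) a = a := rfl

theorem Alg.hom_realize {A B : V.Alg} (f : A ⟶ B) {α : Type*} (t : V.lang.Term α)
    (v : α → A.carrier) : f.toFun (t.realize v) = t.realize (fun i => f.toFun (v i)) := by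
  induction t with
  | var i => rfl
  | func o ts ih =>
    simp only [Language.Term.realize, f.map_op]
    congr 1
    funext i
    exact ih i

/-- Locally finite: every finitely generated algebra is finite. -/
def LocallyFinite (V : Variety.{u}) : Prop :=
  ∀ A : V.Alg, Language.Structure.FG V.lang A.carrier → Finite A.carrier

/-- The full subcategory of finite algebras. -/
abbrev FinAlg (V : Variety.{u}) :=
  ObjectProperty.FullSubcategory (fun A : V.Alg => Finite A.carrier)

/-! ### Products and free algebras -/

/-- The finite power `A ^ n`. -/
def Alg.pow (A : V.Alg) (n : ℕ) : V.Alg :=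
  letI : V.lang.Structure (Fin n → A.carrier) :=
    { funMap := fun f x i => Language.Structure.funMap f (fun k => x k i)
      RelMap := fun r => (V.algebraic _).elim r }
  have real : ∀ {α : Type} (t : V.lang.Term α) (v : α → Fin n → A.carrier) (i : Fin n),
      t.realize v i = t.realize (fun k => v k i) := by
    intro α t v i
    induction t with
    | var k => rfl
    | func o ts ih =>
      simp only [Language.Term.realize]
      change Language.Structure.funMap o _ = _
      congr 1
      funext k
      exact ih k
  { carrier := Fin n → A.carrier
    monotone_op := fun f x y h i => A.monotone_op f
      (show (fun k => x k i) ≤ fun k => y k i from fun k => Pi.le_def.1 (h k) i)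
    sat := fun r hr v i => by
      rw [real, real]
      exact A.sat r hr _
    discrete := fun hV a b h => funext fun i => A.discrete hV _ _ (h i) }

/-- The projections of a power. -/
def Alg.proj (A : V.Alg) {n : ℕ} (i : Fin n) : A.pow n ⟶ A :=
  ⟨fun x => x i, fun _ _ => rfl, fun _ _ h => h i⟩

/-- The tupling of a family of morphisms. -/
def Alg.tuple {X A : V.Alg} {n : ℕ} (f : Fin n → (X ⟶ A)) : X ⟶ A.pow n :=
  ⟨fun x i => (f i).toFun x, fun o x => funext fun i => (f i).map_op o x,
    fun _ _ h i => (f i).monotone h⟩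

/-- Two terms over `X` are identified if they have the same value in all algebras of the variety. -/
def termSetoid (V : Variety.{u}) (X : Type u) : Setoid (V.lang.Term X) where
  r s t := ∀ (A : V.Alg) (v : X → A.carrier), s.realize v = t.realize v
  iseqv := ⟨fun _ _ _ => rfl, fun h A v => (h A v).symm, fun h h' A v => (h A v).trans (h' A v)⟩

/-- The underlying set of the free algebra on `X`. -/
def FreeCarrier (V : Variety.{u}) (X : Type u) : Type u := Quotient (V.termSetoid X)

namespace FreeCarrier

variable {X : Type u}

/-- The value of an element of the free algebra under a valuation. -/
def eval (A : V.Alg) (v : X → A.carrier) : V.FreeCarrier X → A.carrier :=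
  Quotient.lift (fun t : V.lang.Term X => t.realize v) (fun _ _ h => h A v)

theorem ext {x y : V.FreeCarrier X} (h : ∀ (A : V.Alg) (v : X → A.carrier),
    eval A v x = eval A v y) : x = y := by
  induction x using Quotient.inductionOn with | _ s => ?_
  induction y using Quotient.inductionOn with | _ t => ?_
  exact Quotient.sound h

noncomputable instance : V.lang.Structure (V.FreeCarrier X) where
  funMap f x := Quotient.mk (V.termSetoid X) (Language.Term.func f fun i => (x i).out)
  RelMap r := (V.algebraic _).elim r

instance : PartialOrder (V.FreeCarrier X) where
  le x y := ∀ (A : V.Alg) (v : X → A.carrier), eval A v x ≤ eval A v y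
  le_refl _ _ _ := le_rfl
  le_trans _ _ _ h h' A v := (h A v).trans (h' A v)
  le_antisymm _ _ h h' := ext fun A v => le_antisymm (h A v) (h' A v)

theorem eval_funMap (A : V.Alg) (v : X → A.carrier) {n : ℕ} (f : V.lang.Functions n)
    (x : Fin n → V.FreeCarrier X) :
    eval A v (Language.Structure.funMap f x) =
      Language.Structure.funMap f (fun i => eval A v (x i)) := by
  change Language.Structure.funMap f (fun i => (x i).out.realize v) = _
  congr 1
  funext i
  conv_rhs => rw [← Quotient.out_eq (x i)]
  rfl

theorem eval_realize (A : V.Alg) (v : X → A.carrier) {α : Type*} (t : V.lang.Term α)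
    (x : α → V.FreeCarrier X) :
    eval A v (t.realize x) = t.realize (fun i => eval A v (x i)) := by
  induction t with
  | var i => rfl
  | func o ts ih =>
    simp only [Language.Term.realize, eval_funMap]
    congr 1
    funext i
    exact ih i

end FreeCarrier

/-- The free algebra of the variety on the set `X`. -/
noncomputable def free (V : Variety.{u}) (X : Type u) : V.Alg where
  carrier := V.FreeCarrier X
  monotone_op f _ _ h A v := by
    rw [FreeCarrier.eval_funMap, FreeCarrier.eval_funMap]
    exact A.monotone_op f fun i => h i A v
  sat r hr x A v := by
    rw [FreeCarrier.eval_realize, FreeCarrier.eval_realize]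
    exact A.sat r hr _
  discrete hV _ _ h := FreeCarrier.ext fun A v => A.discrete hV _ _ (h A v)

/-- The inclusion of the generators. -/
def free.of (V : Variety.{u}) {X : Type u} (x : X) : (V.free X).carrier :=
  Quotient.mk (V.termSetoid X) (Language.Term.var x)

/-- The extension of a map on generators to the free algebra. -/
def free.desc {X : Type u} {A : V.Alg} (v : X → A.carrier) : V.free X ⟶ A :=
  ⟨FreeCarrier.eval A v, FreeCarrier.eval_funMap A v, fun _ _ h => h A v⟩

theorem free.mk_eq_realize {X : Type u} (t : V.lang.Term X) :
    (Quotient.mk (V.termSetoid X) t : (V.free X).carrier) = t.realize (free.of V) := by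
  refine FreeCarrier.ext fun A v => ?_
  exact (FreeCarrier.eval_realize A v t fun x => free.of V x).symm

/-- The universal property of the free algebra. -/
def free.homEquiv (X : Type u) (A : V.Alg) : (V.free X ⟶ A) ≃ (X → A.carrier) where
  toFun f x := f.toFun (free.of V x)
  invFun v := free.desc v
  left_inv f := by
    refine Alg.hom_ext fun a => ?_
    induction a using Quotient.inductionOn with | _ t => ?_
    rw [free.mk_eq_realize, Alg.hom_realize, Alg.hom_realize]
    rfl
  right_inv _ := rfl

theorem free.finite (hV : V.LocallyFinite) (X : Type u) [Finite X] :
    Finite (V.free X).carrier := by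
  refine hV _ (Language.Structure.fg_iff.2 ⟨Set.range (free.of V), Set.finite_range _, ?_⟩)
  refine eq_top_iff.2 fun a _ => ?_
  induction a using Quotient.inductionOn with | _ t => ?_
  rw [free.mk_eq_realize]
  induction t with
  | var x => exact Language.Substructure.subset_closure ⟨x, rfl⟩
  | func o ts ih => exact (Language.Substructure.closure V.lang _).fun_mem o _ fun i => ih i trivial

end Variety

/-! ### Duality

`E : 𝒟.FinAlg ≌ 𝒞.FinAlgᵒᵖ` is a dual equivalence between the finite algebras of `𝒟` and of `𝒞`. -/

section Duality

variable {𝒟 𝒞 : Variety.{u}} (h𝒞 : 𝒞.LocallyFinite) (E : 𝒟.FinAlg ≌ 𝒞.FinAlgᵒᵖ)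

/-- The free `𝒞`-algebra on one generator, as a finite algebra. -/
noncomputable def one : 𝒞.FinAlg := ⟨𝒞.free PUnit, Variety.free.finite h𝒞 PUnit⟩

/-- The object of outputs in a single sort: the dual of the free `𝒞`-algebra on one generator. -/
noncomputable def output : 𝒟.FinAlg := E.inverse.obj (Opposite.op (one h𝒞))

/-- For finite `A`, the elements of the dual of `A` are the morphisms from `A` to the object of
outputs: `|E A| ≅ 𝒞(1, E A) ≅ 𝒟(A, E⁻¹ 1)`. -/
noncomputable def elemEquiv (A : 𝒟.FinAlg) :
    (E.functor.obj A).unop.obj.carrier ≃ (A.obj ⟶ (output h𝒞 E).obj) :=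
  (Equiv.funUnique PUnit.{u + 1} _).symm.trans <|
  (Variety.free.homEquiv PUnit.{u + 1} (E.functor.obj A).unop.obj).symm.trans <|
  (ObjectProperty.fullyFaithfulι _).homEquiv.symm.trans <|
  (opEquiv (E.functor.obj A) (Opposite.op (one h𝒞))).symm.trans <|
  (E.toAdjunction.homEquiv A (Opposite.op (one h𝒞))).trans <|
  (ObjectProperty.fullyFaithfulι _).homEquiv

/-- The `𝒞`-operations on `𝒟(A, O)` for finite `A`, transported from the dual `E A` of `A`. -/
noncomputable def finOp (A : 𝒟.FinAlg) {n : ℕ} (γ : 𝒞.lang.Functions n)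
    (p : Fin n → (A.obj ⟶ (output h𝒞 E).obj)) : A.obj ⟶ (output h𝒞 E).obj :=
  elemEquiv h𝒞 E A
    (Language.Structure.funMap γ fun i => (elemEquiv h𝒞 E A).symm (p i))

/-- The finite power `O ^ n` of the object of outputs. -/
noncomputable abbrev outputPow (n : ℕ) : 𝒟.FinAlg :=
  ⟨(output h𝒞 E).obj.pow n, by
    have := (output h𝒞 E).property
    exact inferInstanceAs (Finite (Fin n → (output h𝒞 E).obj.carrier))⟩

/-- The `n`-ary `𝒞`-operation `γ` as a morphism `O ^ n ⟶ O`: the result of applying `γ` to the `n`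
projections, in the dual of `O ^ n`. -/
noncomputable def outputOp {n : ℕ} (γ : 𝒞.lang.Functions n) :
    (output h𝒞 E).obj.pow n ⟶ (output h𝒞 E).obj :=
  finOp h𝒞 E (outputPow h𝒞 E n) γ fun i => Variety.Alg.proj _ i

/-- The `𝒞`-operations on `𝒟(X, O)` for an arbitrary `𝒟`-algebra `X`. By `homOp_comp` below these
are the only operations, natural in `X`, that extend the ones transported from the duals of the
finite algebras. -/
noncomputable def homOp {X : 𝒟.Alg} {n : ℕ} (γ : 𝒞.lang.Functions n)
    (f : Fin n → (X ⟶ (output h𝒞 E).obj)) : X ⟶ (output h𝒞 E).obj :=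
  Variety.Alg.tuple f ≫ outputOp h𝒞 E γ

/-- `elemEquiv` is natural. -/
theorem elemEquiv_naturality {A B : 𝒟.FinAlg} (k : A ⟶ B)
    (x : (E.functor.obj B).unop.obj.carrier) :
    elemEquiv h𝒞 E A ((E.functor.map k).unop.hom.toFun x) = k.hom ≫ elemEquiv h𝒞 E B x := by
  have key : ∀ y : (E.functor.obj B).unop.obj.carrier,
      Variety.free.desc (X := PUnit.{u + 1}) (fun _ => (E.functor.map k).unop.hom.toFun y) =
        Variety.free.desc (fun _ => y) ≫ (E.functor.map k).unop.hom := fun y =>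
    (Variety.free.homEquiv PUnit.{u + 1} _).injective rfl
  have key2 := E.toAdjunction.homEquiv_naturality_left k
    (ObjectProperty.homMk (Variety.free.desc fun _ => x) :
      one h𝒞 ⟶ (E.functor.obj B).unop).op
  have key3 := congrArg (fun f => InducedCategory.Hom.hom f) key2
  refine Eq.trans ?_ key3
  change InducedCategory.Hom.hom (E.toAdjunction.homEquiv A (Opposite.op (one h𝒞))
    (ObjectProperty.homMk (Variety.free.desc fun _ => _) :
      one h𝒞 ⟶ (E.functor.obj A).unop).op) = _
  congr 2
  apply Quiver.Hom.unop_inj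
  apply ObjectProperty.hom_ext
  exact key x

/-- Let `f 0, …, f (n - 1)` factor through a morphism `h` to a finite algebra `A`, via elements
`p 0, …, p (n - 1)` of the dual of `A`. Then `γ (f 0, …, f (n - 1))` factors through `h` via the
element `γ (p 0, …, p (n - 1))` of the dual of `A`. So, if `X` is the limit of a cofiltered diagram
of finite algebras `A`, the continuous morphisms `X ⟶ O` form the filtered colimit in `𝒞` of the
duals of the algebras `A`. -/
theorem homOp_comp {X : 𝒟.Alg} {A : 𝒟.FinAlg} (h : X ⟶ A.obj) {n : ℕ} (γ : 𝒞.lang.Functions n)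
    (p : Fin n → (A.obj ⟶ (output h𝒞 E).obj)) :
    homOp h𝒞 E γ (fun i => h ≫ p i) = h ≫ finOp h𝒞 E A γ p := by
  let k : A ⟶ outputPow h𝒞 E n := ObjectProperty.homMk (Variety.Alg.tuple p)
  have h2 : k.hom ≫ outputOp h𝒞 E γ = finOp h𝒞 E A γ p := by
    refine (elemEquiv_naturality h𝒞 E k _).symm.trans ?_
    unfold finOp
    rw [(E.functor.map k).unop.hom.map_op]
    congr 2
    funext i
    apply (elemEquiv h𝒞 E A).injective
    refine (elemEquiv_naturality h𝒞 E k _).trans ?_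
    refine (congrArg (k.hom ≫ ·) (Equiv.apply_symm_apply _ _)).trans ?_
    exact (Equiv.apply_symm_apply _ (p i)).symm
  exact (Category.assoc h k.hom (outputOp h𝒞 E γ)).trans (congrArg (h ≫ ·) h2)

end Duality

/-! ### Algebras for a monad on `S`-sorted families of `𝒟`-algebras -/

section Sorted

variable {S : Type w} {𝒟 : Variety.{u}}

/-- Quotients in `𝒟 ^ S`: sortwise surjective morphisms. -/
def Surj {X Y : S → 𝒟.Alg} (e : X ⟶ Y) : Prop := ∀ s, Function.Surjective (e s).toFun

/-- Subobjects in `𝒟 ^ S`: sortwise order-reflecting morphisms (for unordered algebras, these are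
the sortwise injective ones, since then `≤` is equality). -/
def OrderReflecting {X Y : S → 𝒟.Alg} (m : X ⟶ Y) : Prop :=
  ∀ s a b, (m s).toFun a ≤ (m s).toFun b → a ≤ b

/-- A unary operation on an object `X` of `𝒟 ^ S`: a morphism `X s ⟶ X t` for some sorts `s`, `t`. -/
structure UnaryOp (X : S → 𝒟.Alg) where
  /-- the input sort -/
  src : S
  /-- the output sort -/
  tgt : S
  /-- the operation -/
  map : X src ⟶ X tgt

/-- `e` is a `U`-quotient: every operation in `U` lifts along `e`. -/
def IsUQuotient {X B : S → 𝒟.Alg} (U : Set (UnaryOp X)) (e : X ⟶ B) : Prop :=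
  ∀ u ∈ U, ∃ v : B u.src ⟶ B u.tgt, u.map ≫ e u.tgt = e u.src ≫ v

variable {T : Monad (S → 𝒟.Alg)}

/-- `e` is a `T`-quotient of `A`: its codomain carries a `T`-algebra structure for which `e` is a
`T`-homomorphism. -/
def IsTQuotient (A : T.Algebra) {B : S → 𝒟.Alg} (e : A.A ⟶ B) : Prop :=
  ∃ b : T.obj B ⟶ B, T.η.app B ≫ b = 𝟙 B ∧ T.μ.app B ≫ b = T.map b ≫ b ∧
    T.map e ≫ b = A.a ≫ e

/-- The free `T`-algebra `T𝚪`, where `𝚪` is the free object of `𝒟 ^ S` on the alphabet `Γ`. -/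
noncomputable abbrev freeAlg (T : Monad (S → 𝒟.Alg)) (Γ : S → Type u) : T.Algebra :=
  (Monad.free T).obj fun s => 𝒟.free (Γ s)

variable (F : ObjectProperty T.Algebra)

/-- A class `F` of finite `T`-algebras closed under quotients, subalgebras and finite products. -/
structure IsClosedClass : Prop where
  finite : ∀ A, F A → ∀ s, Finite (A.A s).carrier
  quotient : ∀ {A B : T.Algebra} (e : A ⟶ B), Surj e.f → F A → F B
  subalgebra : ∀ {A B : T.Algebra} (m : B ⟶ A), OrderReflecting m.f → F A → F B
  product : F.IsClosedUnderFiniteProducts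

/-- `e` is `F`-refinable: it factorizes through an `F`-quotient of `A`. -/
def IsRefinable (A : T.Algebra) {B : S → 𝒟.Alg} (e : A.A ⟶ B) : Prop :=
  ∃ (Q : T.Algebra) (q : A ⟶ Q) (k : Q.A ⟶ B), F Q ∧ Surj q.f ∧ e = q.f ≫ k

/-- `U` is a unary presentation of `A`: for `F`-refinable quotients in `𝒟 ^ S`, the `T`-quotients
are the `U`-quotients. -/
def IsUnaryPresentation (A : T.Algebra) (U : Set (UnaryOp A.A)) : Prop :=
  ∀ (B : S → 𝒟.Alg) (e : A.A ⟶ B), Surj e → IsRefinable F A e →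
    (IsTQuotient A e ↔ IsUQuotient U e)

/-! ### Theories -/

/-- The quotients of `A` with codomain in `F`. -/
structure Quo (A : T.Algebra) where
  /-- the codomain -/
  cod : T.Algebra
  mem : F cod
  /-- the quotient map -/
  map : A ⟶ cod
  surj : Surj map.f

/-- `e ≤ e'` iff `e` factorizes through `e'`. (Isomorphic quotients are not identified, but every
lower set of this preorder is closed under isomorphism, so its ideals are those of the poset.) -/
instance (A : T.Algebra) : Preorder (Quo F A) where
  le e e' := ∃ q : e'.cod ⟶ e.cod, e.map = e'.map ≫ q
  le_refl _ := ⟨𝟙 _, (Category.comp_id _).symm⟩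
  le_trans := by
    rintro e e' e'' ⟨q, h⟩ ⟨q', h'⟩
    exact ⟨q' ≫ q, by rw [h, h', Category.assoc]⟩

/-- A local pseudovariety of `Γ`-generated `F`-algebras: a nonempty directed lower set of quotients
of `T𝚪` with codomain in `F`. -/
abbrev LocalPseudovariety (Γ : S → Type u) := Order.Ideal (Quo F (freeAlg T Γ))

variable {𝔸 : Set (S → Type u)}

/-- An `F`-theory with respect to the class `M Δ Γ` of homomorphisms `T𝚫 ⟶ T𝚪`, for alphabets in
`𝔸`. -/
@[ext]
structure FTheory (M : ∀ Δ Γ : 𝔸, Set (freeAlg T Δ.1 ⟶ freeAlg T Γ.1)) where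
  /-- the local pseudovarieties -/
  toFun : ∀ Γ : 𝔸, LocalPseudovariety F Γ.1
  lift : ∀ (Δ Γ : 𝔸), ∀ g ∈ M Δ Γ, ∀ e ∈ toFun Γ,
    ∃ e' ∈ toFun Δ, ∃ g' : e'.cod ⟶ e.cod, e'.map ≫ g' = g ≫ e.map

noncomputable instance (M : ∀ Δ Γ : 𝔸, Set (freeAlg T Δ.1 ⟶ freeAlg T Γ.1)) :
    PartialOrder (FTheory F M) :=
  PartialOrder.lift FTheory.toFun fun _ _ => FTheory.ext

/-! ### Languages -/

variable {𝒞 : Variety.{u}} (h𝒞 : 𝒞.LocallyFinite) (E : 𝒟.FinAlg ≌ 𝒞.FinAlgᵒᵖ)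

/-- Languages on an object `X` of `𝒟 ^ S` (for instance on `T𝚪`): morphisms to the object of
outputs, which is the same in all sorts. -/
abbrev Lang (X : S → 𝒟.Alg) := X ⟶ fun _ : S => (output h𝒞 E).obj

variable {h𝒞 E}

/-- `L` is `F`-recognizable. -/
def IsRecognizable (A : T.Algebra) (L : Lang h𝒞 E A.A) : Prop :=
  ∃ (B : T.Algebra) (h : A ⟶ B) (p : Lang h𝒞 E B.A), F B ∧ L = h.f ≫ p

/-- The `𝒞`-operations on languages, taken sortwise. -/
noncomputable def langOp {X : S → 𝒟.Alg} {n : ℕ} (γ : 𝒞.lang.Functions n)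
    (L : Fin n → Lang h𝒞 E X) : Lang h𝒞 E X :=
  fun s => homOp h𝒞 E γ fun i => L i s

open Classical in
/-- The derivative `u⁻¹L` of a language with respect to a unary operation `u : X s ⟶ X t`. It is
`L t ∘ u` in sort `s`, and the morphism `⊥` given by the chosen constant `c` of `𝒞` in all other
sorts. -/
noncomputable def derivative {X : S → 𝒟.Alg} (c : 𝒞.lang.Constants) (u : UnaryOp X)
    (L : Lang h𝒞 E X) : Lang h𝒞 E X :=
  Function.update (β := fun r : S => X r ⟶ (output h𝒞 E).obj)
    (fun _ => homOp h𝒞 E c Fin.elim0) u.src (u.map ≫ L u.tgt)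

/-- The diagonal of an `S`-indexed family of languages. -/
def diagonal {X : S → 𝒟.Alg} (L : S → Lang h𝒞 E X) : Lang h𝒞 E X := fun s => L s s

/-- A local variety of languages on a `T`-algebra `A` (in the applications, `A = T𝚪`): a set of
`F`-recognizable languages closed under the operations of `𝒞`, under the derivatives with respect to
the operations in `U`, and under diagonals. -/
structure IsLocalVariety (c : 𝒞.lang.Constants) (A : T.Algebra) (U : Set (UnaryOp A.A))
    (W : Set (Lang h𝒞 E A.A)) : Prop where
  recognizable : ∀ L ∈ W, IsRecognizable F A L
  op_mem : ∀ {n : ℕ} (γ : 𝒞.lang.Functions n) (L : Fin n → Lang h𝒞 E A.A),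
    (∀ i, L i ∈ W) → langOp γ L ∈ W
  derivative_mem : ∀ u ∈ U, ∀ L ∈ W, derivative c u L ∈ W
  diagonal_mem : ∀ L : S → Lang h𝒞 E A.A, (∀ s, L s ∈ W) → diagonal L ∈ W

/-- A variety of languages with respect to the class `M Δ Γ` of homomorphisms `T𝚫 ⟶ T𝚪`, for
alphabets in `𝔸`: a family of local varieties closed under preimages along the homomorphisms
in `M`. -/
@[ext]
structure LangVariety (h𝒞 : 𝒞.LocallyFinite) (E : 𝒟.FinAlg ≌ 𝒞.FinAlgᵒᵖ)
    (c : 𝒞.lang.Constants) (U : ∀ Γ : 𝔸, Set (UnaryOp (freeAlg T Γ.1).A))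
    (M : ∀ Δ Γ : 𝔸, Set (freeAlg T Δ.1 ⟶ freeAlg T Γ.1)) where
  /-- the local varieties -/
  toFun : ∀ Γ : 𝔸, Set (Lang h𝒞 E (freeAlg T Γ.1).A)
  isLocalVariety : ∀ Γ : 𝔸, IsLocalVariety F c (freeAlg T Γ.1) (U Γ) (toFun Γ)
  preimage_mem : ∀ (Δ Γ : 𝔸), ∀ g ∈ M Δ Γ, ∀ L ∈ toFun Γ, g.f ≫ L ∈ toFun Δ

noncomputable instance (c : 𝒞.lang.Constants) (U : ∀ Γ : 𝔸, Set (UnaryOp (freeAlg T Γ.1).A))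
    (M : ∀ Δ Γ : 𝔸, Set (freeAlg T Δ.1 ⟶ freeAlg T Γ.1)) :
    PartialOrder (LangVariety F h𝒞 E c U M) :=
  PartialOrder.lift LangVariety.toFun fun _ _ => LangVariety.ext

end Sorted

/-- A poset is a lattice: any two elements have a supremum and an infimum. -/
def IsLatticeOrder (P : Type*) [PartialOrder P] : Prop :=
  ∀ a b : P, (∃ c, IsLUB {a, b} c) ∧ ∃ c, IsGLB {a, b} c

end Straubing

/-! Over one alphabet, a local variety `W` is sent to the quotients that recognize only languages in
`W` (`quotientsOf`), and an ideal of quotients to the languages that its members recognize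
(`languagesOf`). Both maps are monotone, so the point is that they are mutually inverse.

Duality supplies two facts. For finite `A`, the morphisms from `A` to the output object `O` are the
elements of `E A`; hence 𝒞-closed sets of such morphisms are subalgebras of `E A`, that is,
quotients of `A` (`exists_quotient_of_closed`). Moreover `O` detects the order of finite algebras
(`le_of_output`). So a closed set of morphisms that separates the order contains all morphisms
(`mem_of_closed_of_separating`).

Diagonals make `W` a product of its components, so that duality applies in each sort. A language in
`W` is recognized by some quotient in `F`; cutting this quotient down by duality in every sort
leaves one that recognizes only languages in `W`. Closure under derivatives says exactly that the
unary operations lift to it, and the unary presentation then makes it a `T`-algebra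
(`IsLocalVariety.exists_mem_quotientsOf`). Conversely, a quotient recognizes only finitely many
languages; if all are recognized by an ideal, one member recognizes them all, and the quotient
factorizes through that member (`mem_of_forall_mem_languagesOf`). -/

namespace Straubing

namespace Variety

variable {V : Variety.{u}}

/-! ### Subalgebras, images and products -/

/-- The subalgebra of an algebra on a substructure, with the induced order. -/
def Alg.sub (A : V.Alg) (K : V.lang.Substructure A.carrier) : V.Alg where
  carrier := K
  monotone_op f x y h := A.monotone_op f
    (show (fun k => (x k : A.carrier)) ≤ fun k => (y k : A.carrier) from fun k => h k)
  sat r hr v := by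
    have real (t : V.lang.Term ℕ) :
        ((t.realize v : K) : A.carrier) = t.realize (fun k => (v k : A.carrier)) :=
      (Language.HomClass.realize_term K.subtype).symm
    change ((r.1.realize v : K) : A.carrier) ≤ ((r.2.realize v : K) : A.carrier)
    rw [real, real]
    exact A.sat r hr _
  discrete hV a b h := Subtype.ext (A.discrete hV _ _ h)

/-- The inclusion of a subalgebra. -/
def Alg.subι (A : V.Alg) (K : V.lang.Substructure A.carrier) : A.sub K ⟶ A :=
  ⟨Subtype.val, fun _ _ => rfl, fun _ _ h => h⟩

/-- The range of a morphism. -/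
def Alg.range {A B : V.Alg} (f : A ⟶ B) : V.lang.Substructure B.carrier where
  carrier := Set.range f.toFun
  fun_mem o x hx := by
    choose y hy using hx
    exact ⟨Language.Structure.funMap o y, (f.map_op o y).trans (congrArg _ (funext hy))⟩

/-- The image of a morphism. -/
def Alg.image {A B : V.Alg} (f : A ⟶ B) : V.Alg := B.sub (Alg.range f)

/-- The corestriction of a morphism to its image. -/
def Alg.toImage {A B : V.Alg} (f : A ⟶ B) : A ⟶ Alg.image f :=
  ⟨fun a => ⟨f.toFun a, a, rfl⟩, fun o x => Subtype.ext (f.map_op o x), fun _ _ h => f.monotone h⟩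

/-- The inclusion of the image of a morphism. -/
def Alg.imageι {A B : V.Alg} (f : A ⟶ B) : Alg.image f ⟶ B := B.subι _

theorem Alg.toImage_surjective {A B : V.Alg} (f : A ⟶ B) :
    Function.Surjective (Alg.toImage f).toFun := by
  rintro ⟨_, a, rfl⟩
  exact ⟨a, rfl⟩

/-- The product of a family of algebras. -/
def Alg.pi {ι : Type u} (A : ι → V.Alg) : V.Alg :=
  letI : V.lang.Structure (∀ i, (A i).carrier) :=
    { funMap := fun f x i => Language.Structure.funMap f (fun k => x k i)
      RelMap := fun r => (V.algebraic _).elim r }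
  have real : ∀ {α : Type} (t : V.lang.Term α) (v : α → ∀ i, (A i).carrier) (i : ι),
      t.realize v i = t.realize (fun k => v k i) := by
    intro α t v i
    induction t with
    | var k => rfl
    | func o ts ih =>
      simp only [Language.Term.realize]
      change Language.Structure.funMap o _ = _
      congr 1
      funext k
      exact ih k
  { carrier := ∀ i, (A i).carrier
    monotone_op := fun f x y h i => (A i).monotone_op f
      (show (fun k => x k i) ≤ fun k => y k i from fun k => Pi.le_def.1 (h k) i)
    sat := fun r hr v i => by
      rw [real, real]
      exact (A i).sat r hr _
    discrete := fun hV a b h => funext fun i => (A i).discrete hV _ _ (h i) }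

/-- The projections of a product. -/
def Alg.piProj {ι : Type u} (A : ι → V.Alg) (i : ι) : Alg.pi A ⟶ A i :=
  ⟨fun x => x i, fun _ _ => rfl, fun _ _ h => h i⟩

/-- The morphism to a product with given components. -/
def Alg.piLift {ι : Type u} {X : V.Alg} {A : ι → V.Alg} (f : ∀ i, X ⟶ A i) : X ⟶ Alg.pi A :=
  ⟨fun x i => (f i).toFun x, fun o x => funext fun i => (f i).map_op o x,
    fun _ _ h i => (f i).monotone h⟩

/-! ### Surjective morphisms -/

theorem Alg.congr_toFun {A B : V.Alg} {f g : A ⟶ B} (h : f = g) (a : A.carrier) :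
    f.toFun a = g.toFun a := h ▸ rfl

theorem Alg.epi_of_surjective {A B : V.Alg} (f : A ⟶ B) (hf : Function.Surjective f.toFun) :
    Epi f := by
  refine ⟨fun g h e => Alg.hom_ext fun b => ?_⟩
  obtain ⟨a, rfl⟩ := hf b
  exact Alg.congr_toFun e a

/-- A morphism factorizes through a surjective one if it is compatible with the preorder that the
latter induces. -/
theorem Alg.exists_lift {X Y Z : V.Alg} (e : X ⟶ Y) (he : Function.Surjective e.toFun) (f : X ⟶ Z)
    (h : ∀ a b, e.toFun a ≤ e.toFun b → f.toFun a ≤ f.toFun b) : ∃ g : Y ⟶ Z, f = e ≫ g := by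
  choose r hr using he
  -- The hypothesis applies in both directions, so antisymmetry makes `f` independent of the section
  -- `r`.
  have key (x : X.carrier) : f.toFun (r (e.toFun x)) = f.toFun x :=
    le_antisymm (h _ _ (hr _).le) (h _ _ (hr _).ge)
  refine ⟨⟨fun y => f.toFun (r y), fun o y => ?_, fun y y' hy => h _ _ ?_⟩,
    Alg.hom_ext fun x => (key x).symm⟩
  · have h1 : Language.Structure.funMap o y = e.toFun (Language.Structure.funMap o (r ∘ y)) := by
      rw [e.map_op]
      congr 1
      funext i
      exact (hr _).symm
    rw [h1, key, f.map_op]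
    rfl
  · rwa [hr, hr]

/-- A surjective morphism that reflects the order is invertible. -/
theorem Alg.exists_inv {X Y : V.Alg} (e : X ⟶ Y) (he : Function.Surjective e.toFun)
    (h : ∀ a b, e.toFun a ≤ e.toFun b → a ≤ b) : ∃ g : Y ⟶ X, 𝟙 X = e ≫ g :=
  Alg.exists_lift e he (𝟙 X) h

/-- If all epimorphisms of a locally finite variety are surjective, so are those between its finite
algebras. -/
theorem FinAlg.surjective_of_epi (hV : V.LocallyFinite)
    (hepi : ∀ {A B : V.Alg} (f : A ⟶ B), Epi f → Function.Surjective f.toFun)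
    {A B : V.FinAlg} (f : A ⟶ B) [Epi f] : Function.Surjective f.hom.toFun := by
  refine hepi f.hom ⟨fun {X} g h e => ?_⟩
  have := B.property
  -- The test morphisms `g`, `h` have finite images, so they land in a finitely generated, hence
  -- finite, subalgebra, where `f` is known to be epi.
  let K : V.lang.Substructure X.carrier :=
    Language.Substructure.closure V.lang (Set.range g.toFun ∪ Set.range h.toFun)
  have hK : Finite (X.sub K).carrier := by
    refine hV _ ((Language.Substructure.fg_iff_structure_fg K).1 ?_)
    exact Language.Substructure.fg_closure ((Set.finite_range _).union (Set.finite_range _))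
  let Y : V.FinAlg := ⟨X.sub K, hK⟩
  have hmem (b : B.obj.carrier) : g.toFun b ∈ K ∧ h.toFun b ∈ K :=
    ⟨Language.Substructure.subset_closure (Or.inl ⟨b, rfl⟩),
      Language.Substructure.subset_closure (Or.inr ⟨b, rfl⟩)⟩
  let g' : B ⟶ Y := ObjectProperty.homMk ⟨fun b => ⟨g.toFun b, (hmem b).1⟩,
    fun o x => Subtype.ext (g.map_op o x), fun _ _ l => g.monotone l⟩
  let h' : B ⟶ Y := ObjectProperty.homMk ⟨fun b => ⟨h.toFun b, (hmem b).2⟩,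
    fun o x => Subtype.ext (h.map_op o x), fun _ _ l => h.monotone l⟩
  have e' : f ≫ g' = f ≫ h' := ObjectProperty.hom_ext _
    (Alg.hom_ext fun a => Subtype.ext (Alg.congr_toFun e a))
  have e2 := (cancel_epi f).1 e'
  exact Alg.hom_ext fun b =>
    congrArg (fun k : B ⟶ Y => Subtype.val (k.hom.toFun b)) e2

end Variety

/-! ### Duality -/

section Duality

open Variety

variable {𝒟 𝒞 : Variety.{u}} (h𝒞 : 𝒞.LocallyFinite) (E : 𝒟.FinAlg ≌ 𝒞.FinAlgᵒᵖ)

/-- Sets of morphisms to the object of outputs that are closed under the operations of `𝒞` are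
those that factorize through some quotient. -/
theorem exists_quotient_of_closed (h𝒟 : 𝒟.LocallyFinite)
    (hepi : ∀ {A B : 𝒟.Alg} (f : A ⟶ B), Epi f → Function.Surjective f.toFun)
    (I : 𝒟.FinAlg) (P : Set (I.obj ⟶ (output h𝒞 E).obj))
    (hP : ∀ {n : ℕ} (γ : 𝒞.lang.Functions n) (p : Fin n → (I.obj ⟶ (output h𝒞 E).obj)),
      (∀ i, p i ∈ P) → finOp h𝒞 E I γ p ∈ P) :
    ∃ (J : 𝒟.FinAlg) (q : I.obj ⟶ J.obj), Function.Surjective q.toFun ∧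
      ∀ p, p ∈ P ↔ ∃ r : J.obj ⟶ (output h𝒞 E).obj, p = q ≫ r := by
  let B := (E.functor.obj I).unop
  let K : 𝒞.lang.Substructure B.obj.carrier :=
    { carrier := {x | elemEquiv h𝒞 E I x ∈ P}
      fun_mem := fun γ x hx => by
        have := hP γ (fun i => elemEquiv h𝒞 E I (x i)) hx
        unfold finOp at this
        simp only [Equiv.symm_apply_apply] at this
        exact this }
  have := B.property
  let K' : 𝒞.FinAlg := ⟨B.obj.sub K, inferInstanceAs (Finite K)⟩
  -- The dual of this monomorphism is an epimorphism out of `I`, the required quotient.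
  let ι : K' ⟶ B := ObjectProperty.homMk (B.obj.subι K)
  have hι : Mono ι := ⟨fun g h e => ObjectProperty.hom_ext _ (Alg.hom_ext fun a =>
    Subtype.ext (congrArg (fun k => Alg.Hom.toFun (InducedCategory.Hom.hom k) a) e))⟩
  let J := E.functor.objPreimage (Opposite.op K')
  let iso : E.functor.obj J ≅ Opposite.op K' := E.functor.objObjPreimageIso _
  let q : I ⟶ J := E.functor.preimage (ι.op ≫ iso.inv)
  have hq : E.functor.map q = ι.op ≫ iso.inv := E.functor.map_preimage _
  have hqepi : Epi q := by
    have h1 : Epi (E.functor.map q) := by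
      rw [hq]
      have : Epi ι.op := inferInstance
      exact epi_comp _ _
    exact E.functor.epi_of_epi_map h1
  have hq' (x) : (E.functor.map q).unop.hom.toFun x = (iso.inv.unop.hom.toFun x).1 := by
    rw [hq]
    rfl
  refine ⟨J, q.hom, FinAlg.surjective_of_epi h𝒟 hepi q, fun p => ⟨fun hp => ?_, ?_⟩⟩
  · let k : K'.obj.carrier := ⟨(elemEquiv h𝒞 E I).symm p, by
      change elemEquiv h𝒞 E I _ ∈ P
      rwa [Equiv.apply_symm_apply]⟩
    refine ⟨elemEquiv h𝒞 E J (iso.hom.unop.hom.toFun k), ?_⟩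
    rw [← elemEquiv_naturality, hq']
    have h2 : iso.hom.unop ≫ iso.inv.unop = 𝟙 _ := by rw [← unop_comp, iso.inv_hom_id]; rfl
    have h3 : iso.inv.unop.hom.toFun (iso.hom.unop.hom.toFun k) = k :=
      congrArg (fun f => Alg.Hom.toFun (InducedCategory.Hom.hom f) k) h2
    rw [h3]
    exact (Equiv.apply_symm_apply _ p).symm
  · rintro ⟨r, rfl⟩
    rw [← (elemEquiv h𝒞 E J).apply_symm_apply r, ← elemEquiv_naturality, hq']
    exact (iso.inv.unop.hom.toFun _).2

/-- The object of outputs cogenerates the finite algebras. -/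
theorem le_of_output (h𝒞_unordered : ¬ 𝒞.ordered) (A : 𝒟.FinAlg) (a b : A.obj.carrier)
    (h : ∀ p : A.obj ⟶ (output h𝒞 E).obj, p.toFun a ≤ p.toFun b) : a ≤ b := by
  have := A.property
  let m : A.obj ⟶ Alg.pi fun _ : A.obj ⟶ (output h𝒞 E).obj => (output h𝒞 E).obj :=
    Alg.piLift fun p => p
  let Q : 𝒟.FinAlg := ⟨Alg.image m, Finite.of_surjective _ (Alg.toImage_surjective m)⟩
  let q : A ⟶ Q := ObjectProperty.homMk (Alg.toImage m)
  -- Every morphism from `A` to the output object is a coordinate of `m`, so it factorizes through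
  -- `q`, uniquely. Dually, `E q` is a bijection.
  have hbij : Function.Bijective (E.functor.map q).unop.hom.toFun := by
    constructor
    · intro x y hxy
      have hxy' := congrArg (elemEquiv h𝒞 E A) hxy
      rw [elemEquiv_naturality, elemEquiv_naturality] at hxy'
      have : Epi (Alg.toImage m) := Alg.epi_of_surjective _ (Alg.toImage_surjective m)
      exact (elemEquiv h𝒞 E Q).injective ((cancel_epi (Alg.toImage m)).1 hxy')
    · intro y
      refine ⟨(elemEquiv h𝒞 E Q).symm (Alg.imageι m ≫ Alg.piProj _ (elemEquiv h𝒞 E A y)), ?_⟩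
      apply (elemEquiv h𝒞 E A).injective
      rw [elemEquiv_naturality, Equiv.apply_symm_apply]
      rfl
  -- In an unordered variety a bijective homomorphism is invertible; with orders this could fail. An
  -- inverse of `E q` yields a retraction of `q`, so `q` reflects the order.
  have hinj (x y) (hxy : (E.functor.map q).unop.hom.toFun x ≤ (E.functor.map q).unop.hom.toFun y) :
      x ≤ y := (hbij.1 (Alg.discrete _ h𝒞_unordered _ _ hxy)).le
  obtain ⟨g, hg⟩ := Alg.exists_inv (E.functor.map q).unop.hom hbij.2 hinj
  let g' : E.functor.obj Q ⟶ E.functor.obj A :=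
    Quiver.Hom.op (ObjectProperty.homMk g : (E.functor.obj A).unop ⟶ (E.functor.obj Q).unop)
  have hg' : E.functor.map q ≫ g' = 𝟙 _ := by
    apply Quiver.Hom.unop_inj
    apply ObjectProperty.hom_ext
    have : g ≫ (E.functor.map q).unop.hom = 𝟙 _ := by
      have : Epi (E.functor.map q).unop.hom := Alg.epi_of_surjective _ hbij.2
      rw [← cancel_epi (E.functor.map q).unop.hom, ← Category.assoc, ← hg]
      rfl
    exact this
  have hk : q ≫ E.functor.preimage g' = 𝟙 A := E.functor.map_injective (by
    rw [E.functor.map_comp, E.functor.map_preimage, hg', E.functor.map_id])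
  have hid (x : A.obj.carrier) : (E.functor.preimage g').hom.toFun (q.hom.toFun x) = x :=
    congrArg (fun f => Alg.Hom.toFun (InducedCategory.Hom.hom f) x) hk
  rw [← hid a, ← hid b]
  exact (E.functor.preimage g').hom.monotone fun p => h p

/-- A set of morphisms to the object of outputs that is closed under the operations of `𝒞` and
separates the order consists of all morphisms. -/
theorem mem_of_closed_of_separating (h𝒟 : 𝒟.LocallyFinite)
    (hepi : ∀ {A B : 𝒟.Alg} (f : A ⟶ B), Epi f → Function.Surjective f.toFun)
    (I : 𝒟.FinAlg) (P : Set (I.obj ⟶ (output h𝒞 E).obj))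
    (hP : ∀ {n : ℕ} (γ : 𝒞.lang.Functions n) (p : Fin n → (I.obj ⟶ (output h𝒞 E).obj)),
      (∀ i, p i ∈ P) → finOp h𝒞 E I γ p ∈ P)
    (hsep : ∀ a b, (∀ p ∈ P, p.toFun a ≤ p.toFun b) → a ≤ b) (p : I.obj ⟶ (output h𝒞 E).obj) :
    p ∈ P := by
  obtain ⟨J, q, hq, hPq⟩ := exists_quotient_of_closed h𝒞 E h𝒟 hepi I P hP
  -- Members of `P` factorize through `q`, so if they separate the order, `q` reflects it and is
  -- invertible.
  obtain ⟨g, hg⟩ := Alg.exists_inv q hq fun a b hab => hsep a b fun p hp => by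
    obtain ⟨r, rfl⟩ := (hPq p).1 hp
    exact r.monotone hab
  refine (hPq p).2 ⟨g ≫ p, ?_⟩
  rw [← Category.assoc, ← hg, Category.id_comp]

end Duality

open Variety

section Sorted

variable {S : Type w} {𝒟 : Variety.{u}}

/-- The forgetful functor creates limits, so this provides the products of `T`-algebras used in
`IsClosedClass.of_separating`. -/
instance : Limits.HasProducts.{u} (S → 𝒟.Alg) :=
  Limits.hasProducts_of_limit_fans
    (fun A => Limits.Fan.mk (fun s => Alg.pi fun i => A i s) fun i _ => Alg.piProj _ i)
    (fun _ => Limits.Fan.IsLimit.mk _ (fun X s => Alg.piLift fun i => X.proj i s) (fun _ _ => rfl)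
      (fun _ _ h => funext fun s => Alg.hom_ext fun a => funext fun i =>
        Alg.congr_toFun (congrFun (h i) s) a))

/-! ### Surjective homomorphisms of algebras for a monad -/

theorem Surj.comp {X Y Z : S → 𝒟.Alg} {e : X ⟶ Y} {f : Y ⟶ Z} (he : Surj e) (hf : Surj f) :
    Surj (e ≫ f) := fun s => (hf s).comp (he s)

theorem Surj.epi {X Y : S → 𝒟.Alg} {e : X ⟶ Y} (he : Surj e) : Epi e := by
  refine ⟨fun g h hgh => funext fun s => ?_⟩
  have := Alg.epi_of_surjective _ (he s)
  exact (cancel_epi (e s)).1 (congrFun hgh s)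

/-- The components of an epimorphism of sorted algebras are epimorphisms. -/
theorem epi_component {X Y : S → 𝒟.Alg} (e : X ⟶ Y) [Epi e] (s : S) : Epi (e s) := by
  refine ⟨fun {Z} g h hgh => ?_⟩
  -- This is a copy of `Z` in sort `s` and an empty product, hence terminal, in all other sorts; so
  -- morphisms out of `Y s` extend to all of `Y`.
  let Z' : S → 𝒟.Alg := fun t => Alg.pi fun _ : ULift.{u} (PLift (s = t)) => Z
  let ext (k : Y s ⟶ Z) : Y ⟶ Z' := fun t => Alg.piLift fun i => eqToHom (by rw [i.down.down]) ≫ k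
  have hext : ext g = ext h := by
    refine (cancel_epi e).1 (funext fun t => Alg.hom_ext fun a => funext fun i => ?_)
    obtain ⟨⟨rfl⟩⟩ := i
    exact Alg.congr_toFun hgh a
  have h2 := congrArg (fun k : Y ⟶ Z' => k s ≫ Alg.piProj _ ⟨⟨rfl⟩⟩) hext
  exact h2

variable {T : Monad (S → 𝒟.Alg)} {F : ObjectProperty T.Algebra}

theorem Surj.map (hepi : ∀ {A B : 𝒟.Alg} (f : A ⟶ B), Epi f → Function.Surjective f.toFun)
    (hT : T.toFunctor.PreservesEpimorphisms) {X Y : S → 𝒟.Alg} {e : X ⟶ Y} (he : Surj e) :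
    Surj (T.map e) := by
  have := he.epi
  have : Epi (T.map e) := hT.preserves e
  exact fun s => hepi _ (epi_component _ s)

/-- The unit and associativity laws are inherited from `A` by cancelling the epimorphisms `e` and `T
(T e)`. -/
theorem isTQuotient_of_comm (hT : T.toFunctor.PreservesEpimorphisms) (A : T.Algebra)
    {B : S → 𝒟.Alg} (e : A.A ⟶ B) (he : Surj e) (b : T.obj B ⟶ B) (hb : T.map e ≫ b = A.a ≫ e) :
    IsTQuotient A e := by
  have := he.epi
  have : Epi (T.map e) := hT.preserves e
  have : Epi (T.map (T.map e)) := hT.preserves (T.map e)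
  refine ⟨b, ?_, ?_, hb⟩
  · rw [← cancel_epi e]
    have h1 := T.η.naturality e
    simp only [Functor.id_map] at h1
    rw [← Category.assoc, h1, Category.assoc, hb, ← Category.assoc, A.unit]
    simp
  · rw [← cancel_epi (T.map (T.map e))]
    have h1 := T.μ.naturality e
    simp only [Functor.comp_map] at h1
    rw [← Category.assoc, h1, Category.assoc, hb, ← Category.assoc, A.assoc, ← Category.assoc,
      ← T.map_comp, hb, T.map_comp, Category.assoc, Category.assoc, hb]

/-- If a homomorphism factorizes through a surjective one, then the second factor is a
homomorphism. -/
theorem exists_hom_of_comp (hT : T.toFunctor.PreservesEpimorphisms) {A B D : T.Algebra} (e : A ⟶ B)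
    (he : Surj e.f) (f : A ⟶ D) (g : B.A ⟶ D.A) (h : f.f = e.f ≫ g) :
    ∃ g' : B ⟶ D, g'.f = g ∧ f = e ≫ g' := by
  have := he.epi
  have : Epi (T.map e.f) := hT.preserves e.f
  have hg : T.map g ≫ D.a = B.a ≫ g := by
    rw [← cancel_epi (T.map e.f), ← Category.assoc, ← T.map_comp, ← h, f.h, h, ← Category.assoc,
      ← Category.assoc, e.h]
  refine ⟨⟨g, hg⟩, rfl, ?_⟩
  ext1
  exact h

/-- Quotients in `𝒟 ^ S` whose order is determined by homomorphisms are quotients of algebras. -/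
theorem isTQuotient_of_separating
    (hepi : ∀ {A B : 𝒟.Alg} (f : A ⟶ B), Epi f → Function.Surjective f.toFun)
    (hT : T.toFunctor.PreservesEpimorphisms) {ι : Type*} (A : T.Algebra) (B : ι → T.Algebra)
    (h : ∀ i, A ⟶ B i) {I : S → 𝒟.Alg} (q : A.A ⟶ I) (hq : Surj q) (k : ∀ i, I ⟶ (B i).A)
    (hk : ∀ i, (h i).f = q ≫ k i)
    (hsep : ∀ s a b, (∀ i, (k i s).toFun a ≤ (k i s).toFun b) → a ≤ b) :
    IsTQuotient A q := by
  have lift (s : S) : ∃ b : (T.obj I) s ⟶ I s, (A.a ≫ q) s = T.map q s ≫ b := by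
    -- After composition with `k i`, the map `A.a ≫ q` factorizes through `T q`, because `h i` is a
    -- homomorphism; and the `k i` together detect the order of `I`.
    refine Alg.exists_lift _ (hq.map hepi hT s) _ fun x y hxy => hsep _ _ _ fun i => ?_
    have h1 : (A.a ≫ q) ≫ k i = T.map q ≫ T.map (k i) ≫ (B i).a := by
      rw [Category.assoc, ← hk, ← (h i).h, hk, T.map_comp, Category.assoc]
    have h2 (z) := Alg.congr_toFun (congrFun h1 s) z
    have h3 := ((T.map (k i) ≫ (B i).a) s).monotone hxy
    exact (h2 x).le.trans (h3.trans (h2 y).ge)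
  choose b hb using lift
  exact isTQuotient_of_comm hT A q hq b (funext fun s => (hb s).symm)

/-- The `k i` together embed `I` into a finite product of algebras in `F`. -/
theorem IsClosedClass.of_separating (hF : IsClosedClass F) {ι : Type u} [Finite ι] (I : T.Algebra)
    (B : ι → T.Algebra) (hB : ∀ i, F (B i)) (k : ∀ i, I ⟶ B i)
    (hsep : ∀ s a b, (∀ i, ((k i).f s).toFun a ≤ ((k i).f s).toFun b) → a ≤ b) : F I := by
  have := hF.product
  have : Limits.HasProduct B := Monad.hasLimit_of_comp_forget_hasLimit (T := T) (Discrete.functor B)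
  refine hF.subalgebra (Limits.Pi.lift k) (fun s a b hab => hsep s a b fun i => ?_)
    (F.prop_product hB)
  have h1 : k i = Limits.Pi.lift k ≫ Limits.Pi.π B i := (Limits.Pi.lift_π k i).symm
  rw [h1]
  exact ((Limits.Pi.π B i).f s).monotone hab

/-- Finitely many homomorphisms to algebras in `F` factorize through a quotient, whose order they
determine. -/
theorem exists_jointImage
    (hepi : ∀ {A B : 𝒟.Alg} (f : A ⟶ B), Epi f → Function.Surjective f.toFun)
    (hT : T.toFunctor.PreservesEpimorphisms) (hF : IsClosedClass F) {ι : Type u} [Finite ι]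
    {A : T.Algebra} (B : ι → T.Algebra) (hB : ∀ i, F (B i)) (h : ∀ i, A ⟶ B i) :
    ∃ (e : Quo F A) (k : ∀ i, e.cod ⟶ B i), (∀ i, h i = e.map ≫ k i) ∧
      ∀ s a b, (∀ i, ((k i).f s).toFun a ≤ ((k i).f s).toFun b) → a ≤ b := by
  let m (s : S) : A.A s ⟶ Alg.pi fun i => (B i).A s := Alg.piLift fun i => (h i).f s
  let I : S → 𝒟.Alg := fun s => Alg.image (m s)
  let q : A.A ⟶ I := fun s => Alg.toImage (m s)
  let k (i : ι) : I ⟶ (B i).A := fun s => Alg.imageι (m s) ≫ Alg.piProj _ i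
  have hq : Surj q := fun s => Alg.toImage_surjective (m s)
  have hk (i : ι) : (h i).f = q ≫ k i := rfl
  -- The image carries the order induced from the product, which is pointwise.
  have hsep (s) (a b : (I s).carrier) (hab : ∀ i, (k i s).toFun a ≤ (k i s).toFun b) : a ≤ b := hab
  obtain ⟨b, h1, h2, h3⟩ := isTQuotient_of_separating hepi hT A B h q hq k hk hsep
  let Q : T.Algebra := ⟨I, b, h1, h2⟩
  let q' : A ⟶ Q := ⟨q, h3⟩
  choose k' hk' hk'' using fun i => exists_hom_of_comp hT q' hq (h i) (k i) (hk i)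
  have hsep' (s) (a b : (Q.A s).carrier)
      (hab : ∀ i, ((k' i).f s).toFun a ≤ ((k' i).f s).toFun b) : a ≤ b := by
    simp only [hk'] at hab
    exact hsep s a b hab
  exact ⟨⟨Q, hF.of_separating Q B hB k' hsep', q', hq⟩, k', hk'', hsep'⟩

/-! ### Components of local varieties of languages -/

variable {𝒞 : Variety.{u}} {h𝒞 : 𝒞.LocallyFinite} {E : 𝒟.FinAlg ≌ 𝒞.FinAlgᵒᵖ}
  {c : 𝒞.lang.Constants} {A : T.Algebra} {U : Set (UnaryOp A.A)} {W : Set (Lang h𝒞 E A.A)}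

/-- The components in sort `s` of the languages in `W`. -/
def component (W : Set (Lang h𝒞 E A.A)) (s : S) : Set (A.A s ⟶ (output h𝒞 E).obj) :=
  {l | ∃ L ∈ W, L s = l}

/-- By closure under diagonals, `W` is the product of its components, so membership may be tested
one sort at a time. -/
theorem IsLocalVariety.mem_iff (hW : IsLocalVariety F c A U W) (L : Lang h𝒞 E A.A) :
    L ∈ W ↔ ∀ s, L s ∈ component W s := by
  refine ⟨fun h s => ⟨L, h, rfl⟩, fun h => ?_⟩
  choose L' hL' h2 using h
  have := hW.diagonal_mem L' hL'
  rwa [show diagonal L' = L from funext h2] at this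

theorem IsLocalVariety.homOp_mem (hW : IsLocalVariety F c A U W) (s : S) {n : ℕ}
    (γ : 𝒞.lang.Functions n) (l : Fin n → (A.A s ⟶ (output h𝒞 E).obj))
    (hl : ∀ i, l i ∈ component W s) : homOp h𝒞 E γ l ∈ component W s := by
  choose L hL h2 using hl
  refine ⟨langOp γ L, hW.op_mem γ L hL, ?_⟩
  unfold langOp
  simp only [h2]

theorem IsLocalVariety.comp_mem (hW : IsLocalVariety F c A U W) (u : UnaryOp A.A) (hu : u ∈ U)
    (l : A.A u.tgt ⟶ (output h𝒞 E).obj) (hl : l ∈ component W u.tgt) :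
    u.map ≫ l ∈ component W u.src := by
  obtain ⟨L, hL, rfl⟩ := hl
  classical
  exact ⟨_, hW.derivative_mem u hu L hL, Function.update_self _ _ _⟩

/-- This is the closure hypothesis needed to apply duality to the morphisms on a finite quotient
whose preimage lies in `W`. -/
theorem IsLocalVariety.finOp_mem (hW : IsLocalVariety F c A U W) (s : S) (B : 𝒟.FinAlg)
    (h : A.A s ⟶ B.obj) {n : ℕ} (γ : 𝒞.lang.Functions n)
    (p : Fin n → (B.obj ⟶ (output h𝒞 E).obj)) (hp : ∀ i, h ≫ p i ∈ component W s) :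
    h ≫ finOp h𝒞 E B γ p ∈ component W s := by
  rw [← homOp_comp]
  exact hW.homOp_mem s γ _ hp

/-! ### From local varieties of languages to local pseudovarieties -/

/-- The quotients that recognize only languages in `W`. -/
def quotientsOf (F : ObjectProperty T.Algebra) (W : Set (Lang h𝒞 E A.A)) : Set (Quo F A) :=
  {e | ∀ p : Lang h𝒞 E e.cod.A, e.map.f ≫ p ∈ W}

/-- The languages recognized through the `k i` lie in `W` and separate the order of the joint image,
so under the 𝒞-operations they generate all languages that it recognizes. Families of size zero, two
and one give nonemptiness, directedness and the lifting property of theories. -/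
theorem IsLocalVariety.exists_jointImage (hW : IsLocalVariety F c A U W)
    (h𝒟 : 𝒟.LocallyFinite)
    (hepi : ∀ {A B : 𝒟.Alg} (f : A ⟶ B), Epi f → Function.Surjective f.toFun)
    (h𝒞_unordered : ¬ 𝒞.ordered)
    (hT : T.toFunctor.PreservesEpimorphisms) (hF : IsClosedClass F) {ι : Type u} [Finite ι]
    (B : ι → T.Algebra) (hB : ∀ i, F (B i)) (h : ∀ i, A ⟶ B i)
    (hp : ∀ i (p : Lang h𝒞 E (B i).A), (h i).f ≫ p ∈ W) :
    ∃ e ∈ quotientsOf F W, ∃ k : ∀ i, e.cod ⟶ B i, ∀ i, h i = e.map ≫ k i := by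
  obtain ⟨e, k, hk, hsep⟩ := Straubing.exists_jointImage hepi hT hF B hB h
  refine ⟨e, fun p => (hW.mem_iff _).2 fun s => ?_, k, hk⟩
  have hconst (i : ι) (r : (B i).A s ⟶ (output h𝒞 E).obj) : (h i).f s ≫ r ∈ component W s := by
    classical
    -- The constant `c` fills the other sorts, so a morphism in one sort extends to a language.
    refine ⟨_, hp i (Function.update (β := fun t : S => (B i).A t ⟶ (output h𝒞 E).obj)
      (fun _ => homOp h𝒞 E c Fin.elim0) s r), ?_⟩
    exact congrArg ((h i).f s ≫ ·) (Function.update_self _ _ _)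
  refine mem_of_closed_of_separating h𝒞 E h𝒟 hepi ⟨e.cod.A s, hF.finite _ e.mem s⟩
    {p | e.map.f s ≫ p ∈ component W s} (fun γ p hp => hW.finOp_mem s _ _ γ p hp)
    (fun a b hab => hsep s a b fun i => ?_) (p s)
  refine le_of_output h𝒞 E h𝒞_unordered ⟨(B i).A s, hF.finite _ (hB i) s⟩ _ _ fun r => ?_
  refine hab ((k i).f s ≫ r) ?_
  have := hconst i r
  rw [hk] at this
  exact this

theorem IsLocalVariety.isIdeal_quotientsOf (hW : IsLocalVariety F c A U W)
    (h𝒟 : 𝒟.LocallyFinite)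
    (hepi : ∀ {A B : 𝒟.Alg} (f : A ⟶ B), Epi f → Function.Surjective f.toFun)
    (h𝒞_unordered : ¬ 𝒞.ordered)
    (hT : T.toFunctor.PreservesEpimorphisms) (hF : IsClosedClass F) :
    Order.IsIdeal (quotientsOf F W) where
  IsLowerSet := by
    rintro e e' ⟨q, hq⟩ he p
    rw [hq]
    exact he (q.f ≫ p)
  Nonempty := by
    obtain ⟨e, he, -⟩ := hW.exists_jointImage h𝒟 hepi h𝒞_unordered hT hF
      (ι := PEmpty) (fun i => i.elim) (fun i => i.elim) (fun i => i.elim) (fun i => i.elim)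
    exact ⟨e, he⟩
  Directed := by
    intro e₁ h₁ e₂ h₂
    let e (i : ULift.{u} Bool) : Quo F A := if i.down then e₁ else e₂
    have he (i) : e i ∈ quotientsOf F W := by
      rcases i with ⟨_ | _⟩
      exacts [h₂, h₁]
    obtain ⟨e', he', k, hk⟩ := hW.exists_jointImage h𝒟 hepi h𝒞_unordered hT hF
      (fun i => (e i).cod) (fun i => (e i).mem) (fun i => (e i).map) he
    exact ⟨e', he', ⟨k ⟨true⟩, hk ⟨true⟩⟩, ⟨k ⟨false⟩, hk ⟨false⟩⟩⟩

/-- Every language of a local variety is recognized by a quotient that recognizes only languages of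
the local variety. -/
theorem IsLocalVariety.exists_mem_quotientsOf (hW : IsLocalVariety F c A U W)
    (h𝒟 : 𝒟.LocallyFinite)
    (hepi : ∀ {A B : 𝒟.Alg} (f : A ⟶ B), Epi f → Function.Surjective f.toFun)
    (h𝒞_unordered : ¬ 𝒞.ordered)
    (hT : T.toFunctor.PreservesEpimorphisms) (hF : IsClosedClass F)
    (hU : IsUnaryPresentation F A U) (L : Lang h𝒞 E A.A) (hL : L ∈ W) :
    ∃ e ∈ quotientsOf F W, ∃ p : Lang h𝒞 E e.cod.A, L = e.map.f ≫ p := by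
  obtain ⟨B, h, p, hB, rfl⟩ := hW.recognizable L hL
  -- A joint image of a single homomorphism: `h` is replaced by a quotient `a` in `F`.
  obtain ⟨a, k, hk, -⟩ := Straubing.exists_jointImage hepi hT hF
    (fun _ : PUnit.{u + 1} => B) (fun _ => hB) (fun _ => h)
  let fin (s : S) : 𝒟.FinAlg := ⟨a.cod.A s, hF.finite _ a.mem s⟩
  have quot (s : S) := exists_quotient_of_closed h𝒞 E h𝒟 hepi (fin s)
    {p | a.map.f s ≫ p ∈ component W s} (fun γ p hp => hW.finOp_mem s (fin s) _ γ p hp)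
  choose J q hq hPq using quot
  let q' : a.cod.A ⟶ fun s => (J s).obj := q
  let e : A.A ⟶ fun s => (J s).obj := a.map.f ≫ q'
  have hq' : Surj q' := hq
  have he : Surj e := a.surj.comp hq'
  have hmem (s : S) (r : (J s).obj ⟶ (output h𝒞 E).obj) : e s ≫ r ∈ component W s :=
    (hPq s (q s ≫ r)).2 ⟨r, rfl⟩
  have hTa : IsTQuotient A a.map.f := ⟨a.cod.a, a.cod.unit, a.cod.assoc, a.map.h⟩
  have hUa := (hU _ a.map.f a.surj ⟨a.cod, a.map, 𝟙 _, a.mem, a.surj, (Category.comp_id _).symm⟩).1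
    hTa
  have hUe : IsUQuotient U e := by
    intro u hu
    obtain ⟨v, hv⟩ := hUa u hu
    -- To descend `v` along `q`, test with morphisms `r` to the output object: `v ≫ q u.tgt ≫ r`
    -- pulls back to a component of a derivative of a language in `W`, so it factorizes through `q
    -- u.src`.
    obtain ⟨v', hv'⟩ := Alg.exists_lift (q u.src) (hq u.src) (v ≫ q u.tgt) fun x y hxy => by
      refine le_of_output h𝒞 E h𝒞_unordered (J u.tgt) _ _ fun r => ?_
      have h1 : v ≫ q u.tgt ≫ r ∈ {p | a.map.f u.src ≫ p ∈ component W u.src} := by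
        have := hW.comp_mem u hu _ (hmem u.tgt r)
        change u.map ≫ (a.map.f u.tgt ≫ q u.tgt) ≫ r ∈ _ at this
        rw [Category.assoc, ← Category.assoc, hv, Category.assoc] at this
        exact this
      obtain ⟨r', hr'⟩ := (hPq u.src (v ≫ q u.tgt ≫ r)).1 h1
      have h2 (z) := Alg.congr_toFun hr' z
      exact (h2 x).le.trans ((r'.monotone hxy).trans (h2 y).ge)
    refine ⟨v', ?_⟩
    change u.map ≫ a.map.f u.tgt ≫ q u.tgt = (a.map.f u.src ≫ q u.src) ≫ v'
    rw [← Category.assoc, hv, Category.assoc, hv', Category.assoc]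
  obtain ⟨b, h1, h2, h3⟩ := (hU _ e he ⟨a.cod, a.map, q', a.mem, a.surj, rfl⟩).2 hUe
  let Q : T.Algebra := ⟨fun s => (J s).obj, b, h1, h2⟩
  let e' : A ⟶ Q := ⟨e, h3⟩
  obtain ⟨q'', hq'', -⟩ := exists_hom_of_comp hT a.map a.surj e' q' rfl
  have hQ : F Q := hF.quotient q'' (by rw [hq'']; exact hq') a.mem
  have hp (s : S) : ∃ r, ((k ⟨⟩).f ≫ p) s = q s ≫ r := by
    refine (hPq s _).1 ⟨_, hL, ?_⟩
    rw [hk ⟨⟩]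
    rfl
  choose r hr using hp
  refine ⟨⟨Q, hQ, e', he⟩, fun p => (hW.mem_iff _).2 fun s => hmem s (p s), r, funext fun s => ?_⟩
  rw [hk ⟨⟩]
  change a.map.f s ≫ ((k ⟨⟩).f ≫ p) s = (a.map.f s ≫ q s) ≫ r s
  rw [hr, Category.assoc]

/-! ### From local pseudovarieties to local varieties of languages -/

/-- The languages recognized by the quotients in `I`. -/
def languagesOf (h𝒞 : 𝒞.LocallyFinite) (E : 𝒟.FinAlg ≌ 𝒞.FinAlgᵒᵖ) (I : Order.Ideal (Quo F A)) :
    Set (Lang h𝒞 E A.A) :=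
  {L | ∃ e ∈ I, ∃ p : Lang h𝒞 E e.cod.A, L = e.map.f ≫ p}

/-- A larger quotient recognizes more languages, and directedness bounds finitely many quotients. -/
theorem exists_common_quotient (I : Order.Ideal (Quo F A)) {ι : Type*} [Finite ι]
    (L : ι → Lang h𝒞 E A.A) (hL : ∀ i, L i ∈ languagesOf h𝒞 E I) :
    ∃ e ∈ I, ∃ p : ι → Lang h𝒞 E e.cod.A, ∀ i, L i = e.map.f ≫ p i := by
  choose e he p hp using hL
  have : Nonempty (I : Set (Quo F A)) := I.nonempty.to_subtype
  obtain ⟨z, hz⟩ := I.directed.directed_val.finite_le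
    (fun i => (⟨e i, he i⟩ : (I : Set (Quo F A))))
  choose q hq using hz
  refine ⟨z.1, z.2, fun i => (q i).f ≫ p i, fun i => ?_⟩
  have h1 : (e i).map.f = z.1.map.f ≫ (q i).f := congrArg Monad.Algebra.Hom.f (hq i)
  rw [hp, h1, Category.assoc]

/-- The filler in a derivative thus factorizes through any morphism to a finite algebra. -/
theorem homOp_const {X : 𝒟.Alg} {B : 𝒟.FinAlg} (h : X ⟶ B.obj) (c : 𝒞.lang.Constants) :
    homOp h𝒞 E c Fin.elim0 = h ≫ finOp h𝒞 E B c Fin.elim0 := by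
  rw [← homOp_comp]
  congr 1
  exact Subsingleton.elim _ _

theorem isLocalVariety_languagesOf [Finite S] (hF : IsClosedClass F)
    (hU : IsUnaryPresentation F A U) (c : 𝒞.lang.Constants) (I : Order.Ideal (Quo F A)) :
    IsLocalVariety F c A U (languagesOf h𝒞 E I) where
  recognizable := by
    rintro _ ⟨e, -, p, rfl⟩
    exact ⟨e.cod, e.map, p, e.mem, rfl⟩
  op_mem := by
    intro n γ L hL
    obtain ⟨e, he, p, hp⟩ := exists_common_quotient I L hL
    refine ⟨e, he, fun s => finOp h𝒞 E ⟨e.cod.A s, hF.finite _ e.mem s⟩ γ fun i => p i s,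
      funext fun s => ?_⟩
    simp only [langOp, hp]
    exact homOp_comp h𝒞 E (A := ⟨e.cod.A s, hF.finite _ e.mem s⟩) (e.map.f s) γ fun i => p i s
  derivative_mem := by
    rintro u hu _ ⟨e, he, p, rfl⟩
    have hTe : IsTQuotient A e.map.f := ⟨e.cod.a, e.cod.unit, e.cod.assoc, e.map.h⟩
    obtain ⟨v, hv⟩ := (hU _ e.map.f e.surj
      ⟨e.cod, e.map, 𝟙 _, e.mem, e.surj, (Category.comp_id _).symm⟩).1 hTe u hu
    -- Deriving by `u` upstairs is deriving by its lift `v` on the quotient.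
    refine ⟨e, he, derivative c ⟨u.src, u.tgt, v⟩ p, funext fun s => ?_⟩
    change _ = e.map.f s ≫ derivative c ⟨u.src, u.tgt, v⟩ p s
    unfold derivative
    classical
    by_cases hs : s = u.src
    · subst hs
      rw [Function.update_self, Function.update_self]
      change u.map ≫ e.map.f u.tgt ≫ p u.tgt = _
      rw [← Category.assoc, hv, Category.assoc]
    · rw [Function.update_of_ne hs, Function.update_of_ne hs]
      have hfin : Finite (e.cod.A s).carrier := hF.finite _ e.mem s
      rw [homOp_const (B := ⟨e.cod.A s, hfin⟩) (e.map.f s),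
        homOp_const (B := ⟨e.cod.A s, hfin⟩) (𝟙 (e.cod.A s)), Category.id_comp]
  diagonal_mem := by
    intro L hL
    obtain ⟨e, he, p, hp⟩ := exists_common_quotient I L hL
    refine ⟨e, he, fun s => p s s, funext fun s => ?_⟩
    exact congrFun (hp s) s

/-- A quotient that recognizes only languages recognized by quotients in the ideal `I` belongs
to `I`. -/
theorem mem_of_forall_mem_languagesOf [Finite S]
    (hT : T.toFunctor.PreservesEpimorphisms) (h𝒞_unordered : ¬ 𝒞.ordered)
    (hF : IsClosedClass F) (c : 𝒞.lang.Constants)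
    (I : Order.Ideal (Quo F A)) (e : Quo F A)
    (he : ∀ p : Lang h𝒞 E e.cod.A, e.map.f ≫ p ∈ languagesOf h𝒞 E I) : e ∈ I := by
  have hfin (s : S) := hF.finite _ e.mem s
  have hfin' : Finite (output h𝒞 E).obj.carrier := (output h𝒞 E).property
  have : Finite (Lang h𝒞 E e.cod.A) := Finite.of_injective
    (β := ∀ s, (e.cod.A s).carrier → (output h𝒞 E).obj.carrier) (fun p s => (p s).toFun)
    fun p p' h => funext fun s => Alg.hom_ext fun a => congrFun (congrFun h s) a
  -- Only finitely many languages live on `e.cod`, so a single `e'` in `I` recognizes them all; `e`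
  -- then factorizes through `e'` because these languages detect the order of `e.cod`.
  obtain ⟨e', he', p', hp'⟩ := exists_common_quotient I _ he
  refine I.lower ?_ he'
  have lift (s : S) := Alg.exists_lift (e'.map.f s) (e'.surj s) (e.map.f s) fun x y hxy => by
    refine le_of_output h𝒞 E h𝒞_unordered ⟨e.cod.A s, hfin s⟩ _ _ fun r => ?_
    classical
    let p : Lang h𝒞 E e.cod.A :=
      Function.update (β := fun t : S => e.cod.A t ⟶ (output h𝒞 E).obj)
        (fun _ => homOp h𝒞 E c Fin.elim0) s r
    have hps : p s = r := Function.update_self _ _ _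
    have h1 (z) := Alg.congr_toFun (congrFun (hp' p) s) z
    rw [← hps]
    exact (h1 x).le.trans (((p' p s).monotone hxy).trans (h1 y).ge)
  choose q hq using lift
  obtain ⟨q', -, h2⟩ := exists_hom_of_comp hT e'.map e'.surj e.map q (funext hq)
  exact ⟨q', h2⟩

/-! ### The isomorphism -/

variable {𝔸 : Set (S → Type u)} {UU : ∀ Γ : 𝔸, Set (UnaryOp (freeAlg T Γ.1).A)}
  {M : ∀ Δ Γ : 𝔸, Set (freeAlg T Δ.1 ⟶ freeAlg T Γ.1)}

/-- The variety of languages recognized by a theory. -/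
noncomputable def FTheory.langVariety [Finite S] (h𝒞 : 𝒞.LocallyFinite) (E : 𝒟.FinAlg ≌ 𝒞.FinAlgᵒᵖ)
    (hF : IsClosedClass F) (hU : ∀ Γ : 𝔸, IsUnaryPresentation F (freeAlg T Γ.1) (UU Γ))
    (c : 𝒞.lang.Constants) (Θ : FTheory F M) : LangVariety F h𝒞 E c UU M where
  toFun Γ := languagesOf h𝒞 E (Θ.toFun Γ)
  isLocalVariety Γ := isLocalVariety_languagesOf hF (hU Γ) c _
  preimage_mem := by
    rintro Δ Γ g hg _ ⟨e, he, p, rfl⟩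
    obtain ⟨e', he', g', h⟩ := Θ.lift Δ Γ g hg e he
    refine ⟨e', he', g'.f ≫ p, ?_⟩
    have h1 : e'.map.f ≫ g'.f = g.f ≫ e.map.f := congrArg Monad.Algebra.Hom.f h
    rw [← Category.assoc, ← h1, Category.assoc]

/-- The theory of the quotients that recognize only languages of a variety of languages. -/
noncomputable def LangVariety.theory (h𝒟 : 𝒟.LocallyFinite)
    (hepi : ∀ {A B : 𝒟.Alg} (f : A ⟶ B), Epi f → Function.Surjective f.toFun)
    (h𝒞_unordered : ¬ 𝒞.ordered)
    (hT : T.toFunctor.PreservesEpimorphisms) (hF : IsClosedClass F)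
    (W : LangVariety F h𝒞 E c UU M) : FTheory F M where
  toFun Γ :=
    ((W.isLocalVariety Γ).isIdeal_quotientsOf h𝒟 hepi h𝒞_unordered hT hF).toIdeal
  lift := by
    intro Δ Γ g hg e he
    obtain ⟨e', he', k, hk⟩ := (W.isLocalVariety Δ).exists_jointImage h𝒟 hepi h𝒞_unordered hT hF
      (fun _ : PUnit.{u + 1} => e.cod) (fun _ => e.mem) (fun _ => g ≫ e.map)
      (fun _ p => W.preimage_mem Δ Γ g hg _ (he p))
    exact ⟨e', he', k ⟨⟩, (hk ⟨⟩).symm⟩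

/-- Varieties of languages correspond to theories. -/
noncomputable def langVarietyEquiv [Finite S] (h𝒟 : 𝒟.LocallyFinite)
    (hepi : ∀ {A B : 𝒟.Alg} (f : A ⟶ B), Epi f → Function.Surjective f.toFun)
    (h𝒞_unordered : ¬ 𝒞.ordered)
    (hT : T.toFunctor.PreservesEpimorphisms) (hF : IsClosedClass F)
    (hU : ∀ Γ : 𝔸, IsUnaryPresentation F (freeAlg T Γ.1) (UU Γ)) :
    LangVariety F h𝒞 E c UU M ≃o FTheory F M :=
  have left (W : LangVariety F h𝒞 E c UU M) :
      (W.theory h𝒟 hepi h𝒞_unordered hT hF).langVariety h𝒞 E hF hU c = W := by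
    refine LangVariety.ext (funext fun Γ => Set.ext fun L => ⟨?_, fun hL => ?_⟩)
    · rintro ⟨e, he, p, rfl⟩
      exact he p
    · exact (W.isLocalVariety Γ).exists_mem_quotientsOf h𝒟 hepi h𝒞_unordered hT hF (hU Γ) L hL
  have right (Θ : FTheory F M) :
      (Θ.langVariety h𝒞 E hF hU c).theory h𝒟 hepi h𝒞_unordered hT hF = Θ := by
    refine FTheory.ext (funext fun Γ => Order.Ideal.ext (Set.ext fun e => ⟨fun he => ?_, ?_⟩))
    · exact mem_of_forall_mem_languagesOf hT h𝒞_unordered hF c _ e he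
    · exact fun he p => ⟨e, he, p, rfl⟩
  have mono {W W' : LangVariety F h𝒞 E c UU M} (h : W ≤ W') :
      W.theory h𝒟 hepi h𝒞_unordered hT hF ≤ W'.theory h𝒟 hepi h𝒞_unordered hT hF :=
    fun Γ _ he p => h Γ (he p)
  have mono' {Θ Θ' : FTheory F M} (h : Θ ≤ Θ') :
      Θ.langVariety h𝒞 E hF hU c ≤ Θ'.langVariety h𝒞 E hF hU c :=
    fun Γ _ ⟨e, he, p, hp⟩ => ⟨e, h Γ he, p, hp⟩
  { toFun := LangVariety.theory h𝒟 hepi h𝒞_unordered hT hF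
    invFun := FTheory.langVariety h𝒞 E hF hU c
    left_inv := left
    right_inv := right
    map_rel_iff' := fun {W W'} => ⟨fun h => left W ▸ left W' ▸ mono' h, mono⟩ }

/-! ### Lattices -/

/-- The intersection of a nonempty set of varieties of languages. -/
def LangVariety.inter (X : Set (LangVariety F h𝒞 E c UU M)) (hX : X.Nonempty) :
    LangVariety F h𝒞 E c UU M where
  toFun Γ := {L | ∀ W ∈ X, L ∈ W.toFun Γ}
  isLocalVariety Γ :=
    -- Recognizability is not a closure condition; it is inherited from some member of `X`, which
    -- must therefore be nonempty.
    { recognizable := fun L hL => (hX.some.isLocalVariety Γ).recognizable L (hL _ hX.some_mem)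
      op_mem := fun γ L hL W hW => (W.isLocalVariety Γ).op_mem γ L fun i => hL i W hW
      derivative_mem := fun u hu L hL W hW =>
        (W.isLocalVariety Γ).derivative_mem u hu L (hL W hW)
      diagonal_mem := fun L hL W hW => (W.isLocalVariety Γ).diagonal_mem L fun s => hL s W hW }
  preimage_mem Δ Γ g hg L hL W hW := W.preimage_mem Δ Γ g hg L (hL W hW)

theorem LangVariety.isGLB_inter (X : Set (LangVariety F h𝒞 E c UU M)) (hX : X.Nonempty) :
    IsGLB X (LangVariety.inter X hX) :=
  ⟨fun W hW _ _ hL => hL W hW, fun _ hV Γ _ hL _ hW => hV hW Γ hL⟩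

/-- The theory of all quotients. -/
noncomputable def topTheory (hepi : ∀ {A B : 𝒟.Alg} (f : A ⟶ B), Epi f → Function.Surjective f.toFun)
    (hT : T.toFunctor.PreservesEpimorphisms) (hF : IsClosedClass F) : FTheory F M where
  toFun Γ := Order.IsIdeal.toIdeal (I := Set.univ)
    { IsLowerSet := isLowerSet_univ
      Nonempty := by
        obtain ⟨e, -⟩ := exists_jointImage hepi hT hF (A := freeAlg T Γ.1)
          (ι := PEmpty) (fun i => i.elim) (fun i => i.elim) (fun i => i.elim)
        exact ⟨e, trivial⟩
      Directed := by
        intro e₁ _ e₂ _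
        let e (i : ULift.{u} Bool) : Quo F (freeAlg T Γ.1) := if i.down then e₁ else e₂
        obtain ⟨e', k, hk, -⟩ := exists_jointImage hepi hT hF
          (fun i => (e i).cod) (fun i => (e i).mem) (fun i => (e i).map)
        exact ⟨e', trivial, ⟨k ⟨true⟩, hk ⟨true⟩⟩, ⟨k ⟨false⟩, hk ⟨false⟩⟩⟩ }
  lift := by
    intro Δ Γ g _ e _
    obtain ⟨e', k, hk, -⟩ := exists_jointImage hepi hT hF
      (fun _ : PUnit.{u + 1} => e.cod) (fun _ => e.mem) (fun _ => g ≫ e.map)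
    exact ⟨e', trivial, k ⟨⟩, (hk ⟨⟩).symm⟩

theorem le_topTheory (hepi : ∀ {A B : 𝒟.Alg} (f : A ⟶ B), Epi f → Function.Surjective f.toFun)
    (hT : T.toFunctor.PreservesEpimorphisms) (hF : IsClosedClass F) (Θ : FTheory F M) :
    Θ ≤ topTheory hepi hT hF :=
  fun _ _ _ => trivial

end Sorted

/-- A poset with a greatest element in which nonempty sets have infima is a lattice. -/
theorem isLatticeOrder_of_isGLB {P : Type*} [PartialOrder P] (t : P) (ht : ∀ a, a ≤ t)
    (h : ∀ X : Set P, X.Nonempty → ∃ c, IsGLB X c) : IsLatticeOrder P := by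
  refine fun a b => ⟨?_, h _ ⟨a, Or.inl rfl⟩⟩
  obtain ⟨c, hc⟩ := h (upperBounds {a, b}) ⟨t, fun x _ => ht x⟩
  exact ⟨c, isGLB_upperBounds.1 hc⟩

theorem IsLatticeOrder.of_orderIso {P Q : Type*} [PartialOrder P] [PartialOrder Q] (f : P ≃o Q)
    (h : IsLatticeOrder P) : IsLatticeOrder Q := by
  intro a b
  obtain ⟨⟨x, hx⟩, y, hy⟩ := h (f.symm a) (f.symm b)
  refine ⟨⟨f x, ?_⟩, f y, ?_⟩
  · simpa [Set.image_pair] using f.isLUB_image'.2 hx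
  · simpa [Set.image_pair] using f.isGLB_image'.2 hy

end Straubing

theorem mainTheorem11 {S : Type w} [Finite S] (𝒟 𝒞 : Straubing.Variety.{u})
    (h𝒟 : 𝒟.LocallyFinite)
    (hepi : ∀ {A B : 𝒟.Alg} (f : A ⟶ B), Epi f → Function.Surjective f.toFun)
    (T : Monad (S → 𝒟.Alg)) (hT : T.toFunctor.PreservesEpimorphisms)
    (F : ObjectProperty T.Algebra) (hF : Straubing.IsClosedClass F)
    (h𝒞_unordered : ¬ 𝒞.ordered) (h𝒞 : 𝒞.LocallyFinite) (c : 𝒞.lang.Constants)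
    (E : 𝒟.FinAlg ≌ 𝒞.FinAlgᵒᵖ)
    (𝔸 : Set (S → Type u)) (h𝔸 : ∀ Γ ∈ 𝔸, ∀ s, Finite (Γ s))
    (U : ∀ Γ : 𝔸, Set (Straubing.UnaryOp (Straubing.freeAlg T Γ.1).A))
    (hU : ∀ Γ : 𝔸, Straubing.IsUnaryPresentation F (Straubing.freeAlg T Γ.1) (U Γ))
    (M : ∀ Δ Γ : 𝔸, Set (Straubing.freeAlg T Δ.1 ⟶ Straubing.freeAlg T Γ.1)) :
    Straubing.IsLatticeOrder (Straubing.LangVariety F h𝒞 E c U M) ∧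
      Straubing.IsLatticeOrder (Straubing.FTheory F M) ∧
      Nonempty (Straubing.LangVariety F h𝒞 E c U M ≃o Straubing.FTheory F M) := by
  have φ : Straubing.LangVariety F h𝒞 E c U M ≃o Straubing.FTheory F M :=
    Straubing.langVarietyEquiv h𝒟 hepi h𝒞_unordered hT hF hU
  have h : Straubing.IsLatticeOrder (Straubing.LangVariety F h𝒞 E c U M) :=
    -- Infima are taken among languages, where they are intersections; the greatest element is taken
    -- among theories, as the theory of all quotients, and transported along `φ`.
    Straubing.isLatticeOrder_of_isGLB (φ.symm (Straubing.topTheory hepi hT hF))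
      (fun W => (OrderIso.le_symm_apply φ).2 (Straubing.le_topTheory hepi hT hF _))
      (fun X hX => ⟨_, Straubing.LangVariety.isGLB_inter X hX⟩)
  exact ⟨h, h.of_orderIso φ, ⟨φ⟩⟩
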